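/- Let $\mathbb F$ be a finite field and $n\ge 1$; indices are taken in $\mathbb Z_n=\mathbb Z/n\mathbb Z$. A (linear tail-biting) trellis $T$ of length $n$ consists of finite-dimensional $\mathbb F$-vector spaces $\mathcal S_i$ (state spaces) and subspaces $\mathcal C_i\subseteq \mathcal S_i\times\mathbb F\times\mathcal S_{i+1}$ (constraint codes, whose elements are called branches), $i\in\mathbb Z_n$. A valid trajectory is a pair $(\mathbf a,\mathbf s)\in\mathbb F^n\times\prod_i\mathcal S_i$ with $(s_i,a_i,s_{i+1})\in\mathcal C_i$ for all $i$; the code realized by $T$ is the set of all $\mathbf a$ occurring in a valid trajectory. The dual trellis $T^\circ$ has state spaces $\hat{\mathcal S}_i=\mathrm{Hom}(\mathcal S_i,\mathbb F)$ and constraint codes $\{(g,b,h)\in\hat{\mathcal S}_i\times\mathbb F\times\hat{\mathcal S}_{i+1} : g(s)+ba-h(s')=0 \text{ for all } (s,a,s')\in\mathcal C_i\}$. $T$ is *state-trim* (*branch-trim*) if every state (every branch) lies on a valid trajectory; *proper* if no $\mathcal C_i$ contains a nonzero branch of the form $(s,0,0)$ or $(0,0,s')$; *span-two-observable* if it contains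 no path of length $n-2$ (that is, $s_i,\dots,s_{i+n-2}$ with $(s_j,a_j,s_{j+1})\in\mathcal C_j$ for $j=i,\dots,i+n-3$) with all symbols $a_j=0$ and not all states zero; *span-two-controllable* if $T^\circ$ is span-two-observable. Two trellises are isomorphic if they coincide up to isomorphisms of the state spaces. A *local reduction* of $T$ at time $i$ is a replacement of $\mathcal S_i$, $\mathcal C_{i-1}$ and $\mathcal C_i$ by spaces of at most the same respective dimensions, all other spaces being unchanged, such that the resulting trellis realizes the same code; it is *strict* if $\dim\mathcal S_i$ strictly decreases. $T$ is *locally irreducible* if each local reduction of $T$ is isomorphic to $T$, and *locally reducible* otherwise. **Theorem.** Let $\mathcal C\subseteq\mathbb F^n$ be a linear code such that neither $\mathcal C$ nor $\mathcal C^\perp$ contains a nonzero codeword supported on a circular interval of length at most $2$, and let $T$ be a trellis realizing $\mathcal C$. Then the following are equivalent: (i) $T$ is locally irreducible; (ii) $T$ is state-trim, branch-trim, proper, span-two-observable and span-two-controllable; (iii) $T^\circ$ is locally irreducible; (iv) $T^\circ$ is state-trim, branch-trim, proper, span-two-observable and span-two-controllable. Furthermore, if $T$ is locally reducible, then at least one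 of the following holds: there is a strict local reduction $T'$ of $T$, at some time $i$, such that $T'^\circ$ is a strict local reduction of $T^\circ$ at time $i$; or there are a local reduction $T'$ of $T$ at some time $i$ and a strict local reduction $T''$ of $T'$ at some time $j$ such that $T'^\circ$ is a local reduction of $T^\circ$ at time $i$ and $T''^\circ$ is a strict local reduction of $T'^\circ$ at time $j$. -/

import Mathlib

universe u

/-- A linear tail-biting trellis realization of length `n` over the field `F`, with all symbol
alphabets equal to `F` and time axis `ZMod n`: finite-dimensional state spaces `S i` and
constraint codes `C i ⊆ S i × F × S (i + 1)`. -/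
structure Trellis (F : Type u) [Field F] (n : ℕ) where
  /-- the state spaces -/
  S : ZMod n → Type u
  [instAddCommGroup : ∀ i, AddCommGroup (S i)]
  [instModule : ∀ i, Module F (S i)]
  [instFiniteDimensional : ∀ i, FiniteDimensional F (S i)]
  /-- the constraint codes; their elements are the branches -/
  C : ∀ i, Submodule F (S i × F × S (i + 1))

attribute [instance] Trellis.instAddCommGroup Trellis.instModule Trellis.instFiniteDimensional

/-- The orthogonal code with respect to the standard inner product. -/
def dualCode {F : Type u} [Field F] {n : ℕ} [NeZero n] (C : Submodule F (ZMod n → F)) :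
    Submodule F (ZMod n → F) where
  carrier := {y | ∀ x ∈ C, ∑ i, x i * y i = 0}
  zero_mem' := by simp
  add_mem' := by
    intro y z hy hz x hx
    simp [mul_add, Finset.sum_add_distrib, hy x hx, hz x hx]
  smul_mem' := by
    intro r y hy x hx
    have h : ∀ i, x i * (r • y) i = r * (x i * y i) := fun i => by
      simp only [Pi.smul_apply, smul_eq_mul]; ring
    simp only [h, ← Finset.mul_sum, hy x hx, mul_zero]

/-- The circular interval `{i, i + 1, …, i + ℓ - 1}` of length `ℓ` in `ZMod n`. -/
def circularInterval {n : ℕ} (i : ZMod n) (ℓ : ℕ) : Set (ZMod n) :=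
  {j | ∃ k : ℕ, k < ℓ ∧ j = i + (k : ZMod n)}

/-- No nonzero codeword is supported on a circular interval of length at most `2`. -/
def NoSpanTwoCodeword {F : Type u} [Field F] {n : ℕ} (C : Submodule F (ZMod n → F)) : Prop :=
  ∀ c ∈ C, ∀ (i : ZMod n) (ℓ : ℕ), ℓ ≤ 2 → Function.support c ⊆ circularInterval i ℓ → c = 0

namespace Trellis

variable {F : Type u} [Field F] {n : ℕ}

/-- The behavior: all pairs of a symbol sequence and a state sequence satisfying all constraints
(the valid trajectories). -/
def behavior (T : Trellis F n) : Submodule F ((ZMod n → F) × (∀ i, T.S i)) where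
  carrier := {p | ∀ i, (p.2 i, p.1 i, p.2 (i + 1)) ∈ T.C i}
  zero_mem' := fun i => (T.C i).zero_mem
  add_mem' := fun hp hq i => (T.C i).add_mem (hp i) (hq i)
  smul_mem' := fun r _ hp i => (T.C i).smul_mem r (hp i)

/-- The code generated (realized) by the trellis. -/
def code (T : Trellis F n) : Submodule F (ZMod n → F) :=
  T.behavior.map (LinearMap.fst F (ZMod n → F) (∀ i, T.S i))

/-- Each state appears on a valid trajectory. -/
def IsStateTrim (T : Trellis F n) : Prop :=
  ∀ (i : ZMod n) (s : T.S i), ∃ p ∈ T.behavior, p.2 i = s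

/-- Each branch appears on a valid trajectory. -/
def IsBranchTrim (T : Trellis F n) : Prop :=
  ∀ (i : ZMod n), ∀ b ∈ T.C i, ∃ p ∈ T.behavior, (p.2 i, p.1 i, p.2 (i + 1)) = b

/-- No constraint code has a nonzero branch of the form `(s, 0, 0)` or `(0, 0, s')`. -/
def IsProper (T : Trellis F n) : Prop :=
  ∀ i : ZMod n, (∀ s : T.S i, (s, (0 : F), (0 : T.S (i + 1))) ∈ T.C i → s = 0) ∧
    (∀ s' : T.S (i + 1), ((0 : T.S i), (0 : F), s') ∈ T.C i → s' = 0)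

/-- The states `s i, s (i + 1), …, s (i + ℓ)` and the symbols `a i, …, a (i + ℓ - 1)` form a path
of length `ℓ` starting at time `i`. It is used for `ℓ < n` only, so that the times visited are
distinct and a path is a restriction of sequences `s`, `a` on the whole time axis; the values of
`s` and `a` at other times play no role. -/
def IsPath (T : Trellis F n) (i : ZMod n) (ℓ : ℕ) (a : ZMod n → F) (s : ∀ j, T.S j) : Prop :=
  ∀ k : ℕ, k < ℓ →
    (s (i + (k : ZMod n)), a (i + (k : ZMod n)), s (i + (k : ZMod n) + 1)) ∈
      T.C (i + (k : ZMod n))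

/-- There is no nontrivial path of length `n - 2` representing the zero word. -/
def IsSpanTwoObservable (T : Trellis F n) : Prop :=
  ∀ (i : ZMod n) (s : ∀ j, T.S j), T.IsPath i (n - 2) 0 s →
    ∀ k : ℕ, k ≤ n - 2 → s (i + (k : ZMod n)) = 0

/-- The dual trellis `T°`: state spaces are replaced by their dual spaces, constraint codes by
their orthogonal spaces, and the sign of each dual state variable is inverted in the constraint
in which it is the end state. The symbol space `F` is identified with its dual. -/
def dual (T : Trellis F n) : Trellis F n where
  S := fun i => Module.Dual F (T.S i)
  C := fun i =>
    { carrier := {y | ∀ x ∈ T.C i, y.1 x.1 + y.2.1 * x.2.1 - y.2.2 x.2.2 = 0}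
      zero_mem' := by simp
      add_mem' := by
        intro y z hy hz x hx
        have h1 := hy x hx
        have h2 := hz x hx
        simp only [Prod.fst_add, Prod.snd_add, LinearMap.add_apply]
        linear_combination h1 + h2
      smul_mem' := by
        intro r y hy x hx
        have h1 := hy x hx
        simp only [Prod.smul_fst, Prod.smul_snd, LinearMap.smul_apply, smul_eq_mul]
        linear_combination r * h1 }

/-- The dual trellis is span-two-observable. -/
def IsSpanTwoControllable (T : Trellis F n) : Prop :=
  T.dual.IsSpanTwoObservable

/-- Two trellises coincide up to state space isomorphisms. -/
def IsIsomorphic (T T' : Trellis F n) : Prop :=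
  ∃ φ : ∀ i, T.S i ≃ₗ[F] T'.S i, ∀ i,
    T'.C i = (T.C i).map ((φ i).prodCongr
      ((LinearEquiv.refl F F).prodCongr (φ (i + 1)))).toLinearMap

/-- `T'` is a local reduction of `T` at time `i`: the state space at time `i` and the incident
constraint codes at times `i - 1` and `i` are replaced by spaces of at most the same dimension,
all other state spaces and constraint codes are unchanged (they are identified through linear
isomorphisms `e j`, `j ≠ i`), and the code realized is the same. -/
def IsLocalReductionAt (i : ZMod n) (T T' : Trellis F n) : Prop :=
  Module.finrank F (T'.S i) ≤ Module.finrank F (T.S i) ∧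
  Module.finrank F (T'.C (i - 1)) ≤ Module.finrank F (T.C (i - 1)) ∧
  Module.finrank F (T'.C i) ≤ Module.finrank F (T.C i) ∧
  (∃ e : ∀ j, j ≠ i → (T.S j ≃ₗ[F] T'.S j), ∀ (j : ZMod n) (h : j ≠ i) (h' : j + 1 ≠ i),
    T'.C j = (T.C j).map ((e j h).prodCongr
      ((LinearEquiv.refl F F).prodCongr (e (j + 1) h'))).toLinearMap) ∧
  T'.code = T.code

/-- A local reduction at time `i` that strictly reduces the state space dimension. -/
def IsStrictLocalReductionAt (i : ZMod n) (T T' : Trellis F n) : Prop :=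
  IsLocalReductionAt i T T' ∧ Module.finrank F (T'.S i) < Module.finrank F (T.S i)

/-- Each local reduction is isomorphic to the original trellis. -/
def IsLocallyIrreducible (T : Trellis F n) : Prop :=
  ∀ (i : ZMod n) (T' : Trellis F n), IsLocalReductionAt i T T' → IsIsomorphic T T'

end Trellis
/-!
If the constraint codes of `T'` are the preimages of those of `T` under injections, both their
dimensions and their codimensions are at most those of `T`, so a local reduction of this kind is one
of the dual trellises as well; restricting a state space to its trim part is the basic example.

When `T°` is state-trim, a zero-symbol path in `T` that violates at most one constraint and passes
through the zero state vanishes. So if a state-trim `T` with state-trim dual has a nonzero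
zero-symbol path `z` from time `m + 2` to time `m`, one may replace `s` by `s - φ (s (m + 1)) • z`
in all trajectories. For a suitable functional `φ` the new trellis or its dual is no longer
state-trim, unless `z` closes up to a trajectory whose codeword is supported on `{m, m + 1}`.

Conversely, let `T` be span-two-observable and span-two-controllable. Any two states at times
`m + 2` and `m` are joined by a path, and the symbols of the path determine its states, so the code
determines the composite of the constraint codes at times `m` and `m + 1`. Any other factorization
of this composite through a space of at most the dimension of the state space at time `m + 1` is
isomorphic to the given one, which is trim and proper, and thus every local reduction at time
`m + 1` is isomorphic to `T`.
-/

section LinearAlgebra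

variable {F : Type*} [Field F]

section BranchPairing

variable {V W : Type*} [AddCommGroup V] [Module F V] [AddCommGroup W] [Module F W]

variable (F V W) in
/-- The identification of `V* × F × W*` with `(V × F × W)*` under which the constraint codes of the
dual trellis are annihilators. The sign is the one of the end states in `Trellis.dual`. -/
def branchPairing :
    (Module.Dual F V × F × Module.Dual F W) ≃ₗ[F] Module.Dual F (V × F × W) :=
  ((LinearEquiv.refl F (Module.Dual F V)).prodCongr
    (((LinearMap.ringLmapEquivSelf F F F).symm.prodCongr (LinearEquiv.neg F)).trans
      (Module.dualProdDualEquivDual F F W))).trans (Module.dualProdDualEquivDual F V (F × W))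

theorem branchPairing_apply (y : Module.Dual F V × F × Module.Dual F W) (x : V × F × W) :
    branchPairing F V W y x = y.1 x.1 + y.2.1 * x.2.1 - y.2.2 x.2.2 := by
  simp only [branchPairing, LinearEquiv.trans_apply, LinearEquiv.prodCongr_apply,
    LinearEquiv.refl_apply, LinearEquiv.neg_apply, Module.dualProdDualEquivDual_apply_apply]
  simp
  ring

end BranchPairing

theorem exists_dualAnnihilator_sum_eq {ι X : Type*} [Fintype ι] {Y : ι → Type*}
    [AddCommGroup X] [Module F X] [∀ i, AddCommGroup (Y i)] [∀ i, Module F (Y i)]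
    (f : ∀ i, X →ₗ[F] Y i) (C : ∀ i, Submodule F (Y i)) {l : Module.Dual F X}
    (hl : ∀ x, (∀ i, f i x ∈ C i) → l x = 0) :
    ∃ ω : ∀ i, Module.Dual F (Y i),
      (∀ i, ω i ∈ (C i).dualAnnihilator) ∧ ∀ x, l x = ∑ i, ω i (f i x) := by
  classical
  let q : X →ₗ[F] ∀ i, Y i ⧸ C i := LinearMap.pi fun i => (C i).mkQ ∘ₗ f i
  have hmem : l ∈ (LinearMap.ker q).dualAnnihilator :=
    (Submodule.mem_dualAnnihilator _).2 fun x hx =>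
      hl x fun i => (Submodule.Quotient.mk_eq_zero _).1 (congrFun (LinearMap.mem_ker.1 hx) i)
  rw [← LinearMap.range_dualMap_eq_dualAnnihilator_ker] at hmem
  obtain ⟨L, rfl⟩ := hmem
  refine ⟨fun i => L ∘ₗ LinearMap.single F (fun i => Y i ⧸ C i) i ∘ₗ (C i).mkQ, fun i => ?_,
    fun x => ?_⟩
  · refine (Submodule.mem_dualAnnihilator _).2 fun y hy => ?_
    simp [(Submodule.Quotient.mk_eq_zero (C i)).2 hy]
  · rw [LinearMap.dualMap_apply, ← Finset.univ_sum_single (q x), map_sum]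
    rfl

section Comap

variable {X Y : Type*} [AddCommGroup X] [Module F X] [AddCommGroup Y] [Module F Y]
  [FiniteDimensional F Y]

theorem finrank_add_finrank_le_finrank_comap_add [FiniteDimensional F X] (f : X →ₗ[F] Y)
    (C : Submodule F Y) :
    Module.finrank F C + Module.finrank F X ≤
      Module.finrank F (C.comap f) + Module.finrank F Y := by
  have hrank := LinearMap.finrank_range_add_finrank_ker (C.mkQ ∘ₗ f)
  have hrange := Submodule.finrank_le (LinearMap.range (C.mkQ ∘ₗ f))
  have hquot := Submodule.finrank_quotient_add_finrank C
  rw [LinearMap.ker_comp, Submodule.ker_mkQ] at hrank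
  omega

theorem finrank_comap_le_of_injective {f : X →ₗ[F] Y} (hf : Function.Injective f)
    (C : Submodule F Y) : Module.finrank F (C.comap f) ≤ Module.finrank F C := by
  rw [(Submodule.equivMapOfInjective f hf (C.comap f)).finrank_eq]
  exact Submodule.finrank_mono (Submodule.map_comap_le f C)

end Comap

section Relations

variable {V V' : Type*} [AddCommGroup V] [Module F V] [FiniteDimensional F V]
  [AddCommGroup V'] [Module F V'] [FiniteDimensional F V']

theorem exists_linearEquiv_of_total_of_injective {R : Submodule F (V × V')}
    (htotal : ∀ v, ∃ v', (v, v') ∈ R) (hinj : ∀ v, (v, (0 : V')) ∈ R → v = 0)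
    (hdim : Module.finrank F V' ≤ Module.finrank F V) :
    ∃ θ : V ≃ₗ[F] V', ∀ v v', (v, v') ∈ R ↔ θ v = v' := by
  let f : R →ₗ[F] V := LinearMap.fst F V V' ∘ₗ R.subtype
  let g : R →ₗ[F] V' := LinearMap.snd F V V' ∘ₗ R.subtype
  have hf : Function.Surjective f := fun v =>
    let ⟨v', h⟩ := htotal v
    ⟨⟨(v, v'), h⟩, rfl⟩
  have hg : Function.Injective g := by
    rw [injective_iff_map_eq_zero]
    rintro ⟨⟨v, v'⟩, h⟩ (rfl : v' = 0)
    exact Subtype.ext (Prod.ext (hinj v h) rfl)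
  have hRV := LinearMap.finrank_le_finrank_of_surjective hf
  have hRV' := LinearMap.finrank_le_finrank_of_injective hg
  have hf' : Function.Bijective f :=
    ⟨(LinearMap.injective_iff_surjective_of_finrank_eq_finrank (by omega)).2 hf, hf⟩
  have hg' : Function.Bijective g :=
    ⟨hg, (LinearMap.injective_iff_surjective_of_finrank_eq_finrank (by omega)).1 hg⟩
  have hθ : ∀ x : R, ((LinearEquiv.ofBijective f hf').symm.trans
      (LinearEquiv.ofBijective g hg')) (f x) = g x := fun x =>
    congrArg g ((LinearEquiv.ofBijective f hf').symm_apply_apply x)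
  refine ⟨(LinearEquiv.ofBijective f hf').symm.trans (LinearEquiv.ofBijective g hg'),
    fun v v' => ⟨fun h => hθ ⟨(v, v'), h⟩, ?_⟩⟩
  rintro rfl
  obtain ⟨x, rfl⟩ := hf v
  rw [hθ x]
  exact x.2

theorem exists_linearEquiv_of_comp_eq {P Q : Type*} [AddCommGroup P] [Module F P]
    [AddCommGroup Q] [Module F Q] {A : Submodule F (P × V)} {B : Submodule F (V × Q)}
    {A' : Submodule F (P × V')} {B' : Submodule F (V' × Q)}
    (hA : ∀ v, ∃ p, (p, v) ∈ A) (hB : ∀ v, ∃ q, (v, q) ∈ B)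
    (hA0 : ∀ v, ((0 : P), v) ∈ A → v = 0) (hB0 : ∀ v, (v, (0 : Q)) ∈ B → v = 0)
    (hcomp : ∀ p q, (∃ v, (p, v) ∈ A ∧ (v, q) ∈ B) ↔ ∃ v, (p, v) ∈ A' ∧ (v, q) ∈ B')
    (hdim : Module.finrank F V' ≤ Module.finrank F V) :
    ∃ θ : V ≃ₗ[F] V', (∀ p v, (p, v) ∈ A ↔ (p, θ v) ∈ A') ∧
      ∀ v q, (v, q) ∈ B ↔ (θ v, q) ∈ B' := by
  let R : Submodule F (V × V') :=
    { carrier := {x | ∃ p q, ((p, x.1) ∈ A ∧ (x.1, q) ∈ B) ∧ (p, x.2) ∈ A' ∧ (x.2, q) ∈ B'}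
      zero_mem' := ⟨0, 0, ⟨A.zero_mem, B.zero_mem⟩, A'.zero_mem, B'.zero_mem⟩
      add_mem' := by
        rintro x y ⟨p, q, ⟨hp, hq⟩, hp', hq'⟩ ⟨r, t, ⟨hr, ht⟩, hr', ht'⟩
        exact ⟨p + r, q + t, ⟨A.add_mem hp hr, B.add_mem hq ht⟩,
          A'.add_mem hp' hr', B'.add_mem hq' ht'⟩
      smul_mem' := by
        rintro c x ⟨p, q, ⟨hp, hq⟩, hp', hq'⟩
        exact ⟨c • p, c • q, ⟨A.smul_mem c hp, B.smul_mem c hq⟩,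
          A'.smul_mem c hp', B'.smul_mem c hq'⟩ }
  have htotal : ∀ v, ∃ v', (v, v') ∈ R := fun v =>
    let ⟨p, hp⟩ := hA v
    let ⟨q, hq⟩ := hB v
    let ⟨v', h⟩ := (hcomp p q).1 ⟨v, hp, hq⟩
    ⟨v', p, q, ⟨hp, hq⟩, h⟩
  have hinj : ∀ v, (v, (0 : V')) ∈ R → v = 0 := by
    rintro v ⟨p, q, ⟨hp, -⟩, hp', -⟩
    obtain ⟨w, hw, hw0⟩ := (hcomp p 0).2 ⟨0, hp', B'.zero_mem⟩
    obtain rfl := hB0 w hw0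
    exact hA0 v (by simpa using A.sub_mem hp hw)
  obtain ⟨θ, hθ⟩ := exists_linearEquiv_of_total_of_injective htotal hinj hdim
  have hcross : ∀ p v q, (p, v) ∈ A ∧ (v, q) ∈ B ↔ (p, θ v) ∈ A' ∧ (θ v, q) ∈ B' := by
    refine fun p v q => ⟨fun h => ?_, fun h => ?_⟩
    · obtain ⟨v', h'⟩ := (hcomp p q).1 ⟨v, h⟩
      rwa [(hθ v v').1 ⟨p, q, h, h'⟩]
    · obtain ⟨w, hw⟩ := (hcomp p q).2 ⟨θ v, h⟩
      rwa [← θ.injective ((hθ w (θ v)).1 ⟨p, q, hw, h⟩)]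
  refine ⟨θ, fun p v => ?_, fun v q => ?_⟩
  all_goals
    obtain ⟨p', hp'⟩ := hA v
    obtain ⟨q', hq'⟩ := hB v
    have h' := (hcross p' v q').1 ⟨hp', hq'⟩
  · exact ⟨fun h => ((hcross p v q').1 ⟨h, hq'⟩).1, fun h => ((hcross p v q').2 ⟨h, h'.2⟩).1⟩
  · exact ⟨fun h => ((hcross p' v q).1 ⟨hp', h⟩).2, fun h => ((hcross p' v q).2 ⟨h'.1, h⟩).2⟩

end Relations

-- If `D` has no `(0, b, y)` with `b ≠ 0`, its elements are determined by their first components,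
-- and `φ w = 1` moves that of `(v, a, w)` to `0`. Otherwise a multiple of `(0, b, y)` cancels `a`.
theorem exists_dual_forall_notMem_or_exists_mem {V W : Type*} [AddCommGroup V] [Module F V]
    [FiniteDimensional F V] [AddCommGroup W] [Module F W] {D : Submodule F (V × F × W)}
    (hD : ∀ y, ((0 : V), (0 : F), y) ∈ D → y = 0) {v : V} {a : F} {w : W}
    (hvaw : (v, a, w) ∈ D) (hw : w ≠ 0) (hv : (v, (0 : F), (0 : W)) ∉ D) :
    ∃ φ : Module.Dual F W,
      (∃ u, ∀ b y, (u + φ y • v, b, y) ∉ D) ∨ ∃ y ≠ 0, (φ y • v, (0 : F), y) ∈ D := by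
  by_cases hb : ∀ b y, ((0 : V), b, y) ∈ D → b = 0
  · obtain ⟨φ, hφ⟩ := Module.Projective.exists_dual_eq_one F hw
    refine ⟨φ, Or.inl ?_⟩
    by_contra! hsurj
    let start : D →ₗ[F] V := LinearMap.fst F V (F × W) ∘ₗ D.subtype
    let sheared : D →ₗ[F] V :=
      start - (φ ∘ₗ LinearMap.snd F F W ∘ₗ LinearMap.snd F V (F × W) ∘ₗ D.subtype).smulRight v
    have hstart : Function.Injective start := by
      rw [injective_iff_map_eq_zero]
      rintro ⟨⟨s, b, y⟩, h⟩ (rfl : s = 0)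
      obtain rfl := hb b y h
      obtain rfl := hD y h
      rfl
    have hsheared : Function.Surjective sheared := fun u =>
      let ⟨b, y, h⟩ := hsurj u
      ⟨⟨_, h⟩, by simp [start, sheared]⟩
    have hinj := IsNoetherian.injective_of_surjective_of_injective _ _ hstart hsheared
    have hzero : (⟨(v, a, w), hvaw⟩ : D) = 0 :=
      (injective_iff_map_eq_zero _).1 hinj _ (by simp [start, sheared, hφ])
    exact hw (congrArg (fun x : D => x.1.2.2) hzero)
  · push Not at hb
    obtain ⟨b, x, hx, hb⟩ := hb
    have hy : (v, (0 : F), w - (a / b) • x) ∈ D := by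
      simpa [div_mul_cancel₀ a hb] using D.sub_mem hvaw (D.smul_mem (a / b) hx)
    have hy0 : w - (a / b) • x ≠ 0 := fun h => hv (h ▸ hy)
    obtain ⟨φ, hφ⟩ := Module.Projective.exists_dual_eq_one F hy0
    exact ⟨φ, Or.inr ⟨_, hy0, by rwa [hφ, one_smul]⟩⟩

end LinearAlgebra

theorem exists_pi_extension {ι : Type*} {α : ι → Type*} {i : ι} (x : α i)
    (f : ∀ j, j ≠ i → α j) : ∃ g : ∀ j, α j, g i = x ∧ ∀ j h, g j = f j h := by
  classical
  refine ⟨fun j => if h : j = i then h ▸ x else f j h, by simp, fun j h => by simp [h]⟩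

section CyclicIndices

variable {n : ℕ}

theorem add_natCast_add_natCast_eq_self_iff (m : ZMod n) {k l : ℕ} (hk : k < n) (hl : 0 < l)
    (hln : l ≤ n) : m + l + k = m ↔ k + l = n := by
  rw [add_assoc, add_eq_left, ← Nat.cast_add, ZMod.natCast_eq_zero_iff]
  refine ⟨fun h => ?_, fun h => by rw [← h, add_comm]⟩
  rw [add_comm]
  exact Nat.eq_of_dvd_of_lt_two_mul (by omega) h (by omega)

theorem add_two_add_natCast_eq_add_one_iff (m : ZMod n) {k : ℕ} (hk : k < n) :
    m + 2 + k = m + 1 ↔ k + 1 = n := by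
  rw [← add_natCast_add_natCast_eq_self_iff (m + 1) hk one_pos (by omega), Nat.cast_one,
    add_assoc m 1 1, one_add_one_eq_two]

theorem add_one_ne_self_of_two_le (hn : 2 ≤ n) (m : ZMod n) : m + 1 ≠ m := by
  have := add_natCast_add_natCast_eq_self_iff m (k := 0) (l := 1) (by omega) one_pos (by omega)
  simp only [Nat.cast_one, Nat.cast_zero, add_zero] at this
  exact this.not.2 (by omega)

theorem add_one_add_one_ne_self (hn : 3 ≤ n) (m : ZMod n) : m + 1 + 1 ≠ m := by
  have := add_natCast_add_natCast_eq_self_iff m (k := 1) (l := 1) (by omega) one_pos (by omega)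
  simp only [Nat.cast_one] at this
  exact this.not.2 (by omega)

variable [NeZero n]

theorem exists_eq_add_natCast (i j : ZMod n) : ∃ k < n, j = i + (k : ZMod n) :=
  ⟨(j - i).val, ZMod.val_lt _, by rw [ZMod.natCast_zmod_val, add_sub_cancel]⟩

theorem eq_of_forall_ne_apply_add_one_eq {α : Type*} {f : ZMod n → α} {m : ZMod n}
    (h : ∀ j, j ≠ m → f (j + 1) = f j) (i j : ZMod n) : f i = f j := by
  have hconst : ∀ k < n, f (m + 1 + (k : ZMod n)) = f (m + 1) := by
    intro k hk
    induction k with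
    | zero => simp
    | succ k ih =>
      have hne := (add_natCast_add_natCast_eq_self_iff m (k := k) (l := 1) (by omega) one_pos
        (by omega)).not.2 (by omega)
      rw [Nat.cast_succ, ← add_assoc, h _ (by simpa using hne), ih (by omega)]
  obtain ⟨k, hk, rfl⟩ := exists_eq_add_natCast (m + 1) i
  obtain ⟨l, hl, rfl⟩ := exists_eq_add_natCast (m + 1) j
  rw [hconst k hk, hconst l hl]

theorem sum_sub_add_one_eq_zero {A : Type*} [AddCommGroup A] (f : ZMod n → A) :
    ∑ j, (f j - f (j + 1)) = 0 := by
  rw [Finset.sum_sub_distrib, sub_eq_zero]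
  exact (Equiv.sum_comp (Equiv.addRight (1 : ZMod n)) f).symm

end CyclicIndices

namespace Trellis

variable {F : Type u} [Field F] {n : ℕ}

/-- The symbol and state sequences that satisfy the constraints at all times outside `A`. The paths
of length `n - 2` from time `m + 2` to time `m` are those of `T.partialBehavior {m, m + 1}`, where
the state at time `m + 1` is arbitrary. -/
def partialBehavior (T : Trellis F n) (A : Set (ZMod n)) :
    Submodule F ((ZMod n → F) × (∀ i, T.S i)) where
  carrier := {p | ∀ i ∉ A, (p.2 i, p.1 i, p.2 (i + 1)) ∈ T.C i}
  zero_mem' := fun i _ => (T.C i).zero_mem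
  add_mem' := fun hp hq i hi => (T.C i).add_mem (hp i hi) (hq i hi)
  smul_mem' := fun r _ hp i hi => (T.C i).smul_mem r (hp i hi)

section Paths

variable {T : Trellis F n} {a a' : ZMod n → F} {s s' : ∀ j, T.S j} {m : ZMod n}

theorem mem_partialBehavior {A : Set (ZMod n)} :
    (a, s) ∈ T.partialBehavior A ↔ ∀ j ∉ A, (s j, a j, s (j + 1)) ∈ T.C j :=
  Iff.rfl

theorem mem_partialBehavior_pair :
    (a, s) ∈ T.partialBehavior {m, m + 1} ↔
      ∀ j, j ≠ m → j ≠ m + 1 → (s j, a j, s (j + 1)) ∈ T.C j := by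
  simp only [mem_partialBehavior, Set.mem_insert_iff, Set.mem_singleton_iff, not_or, and_imp]

theorem mem_code : a ∈ T.code ↔ ∃ s, (a, s) ∈ T.behavior := by
  constructor
  · rintro ⟨⟨a, s⟩, h, rfl⟩
    exact ⟨s, h⟩
  · rintro ⟨s, h⟩
    exact ⟨(a, s), h, rfl⟩

theorem behavior_le_partialBehavior (A : Set (ZMod n)) : T.behavior ≤ T.partialBehavior A :=
  fun _ h j _ => h j

theorem mem_behavior_iff :
    (a, s) ∈ T.behavior ↔ (a, s) ∈ T.partialBehavior {m, m + 1} ∧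
      (s m, a m, s (m + 1)) ∈ T.C m ∧
      (s (m + 1), a (m + 1), s (m + 1 + 1)) ∈ T.C (m + 1) := by
  refine ⟨fun h => ⟨behavior_le_partialBehavior _ h, h m, h (m + 1)⟩, fun h j => ?_⟩
  by_cases hj : j = m
  · exact hj ▸ h.2.1
  by_cases hj' : j = m + 1
  · exact hj' ▸ h.2.2
  · exact mem_partialBehavior_pair.1 h.1 j hj hj'

theorem mem_partialBehavior_pair_congr (ha : ∀ j, j ≠ m → j ≠ m + 1 → a' j = a j)
    (hs : ∀ j, j ≠ m + 1 → s' j = s j) :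
    (a', s') ∈ T.partialBehavior {m, m + 1} ↔ (a, s) ∈ T.partialBehavior {m, m + 1} := by
  rw [mem_partialBehavior_pair, mem_partialBehavior_pair]
  refine forall₃_congr fun j hj hj' => ?_
  rw [ha j hj hj', hs j hj', hs (j + 1) fun h => hj (add_right_cancel h)]

theorem update_update_mem_behavior_iff (hm : m + 1 ≠ m) {x y : F} :
    (Function.update (Function.update a m x) (m + 1) y, s) ∈ T.behavior ↔
      (a, s) ∈ T.partialBehavior {m, m + 1} ∧ (s m, x, s (m + 1)) ∈ T.C m ∧
        (s (m + 1), y, s (m + 1 + 1)) ∈ T.C (m + 1) := by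
  rw [mem_behavior_iff (m := m), Function.update_self, Function.update_of_ne hm.symm,
    Function.update_self, mem_partialBehavior_pair_congr (a := a) (s := s) _ fun _ _ => rfl]
  intro j hj hj'
  rw [Function.update_of_ne hj', Function.update_of_ne hj]

theorem isPath_iff_mem_partialBehavior [NeZero n] (hn : 2 ≤ n) :
    T.IsPath (m + 2) (n - 2) a s ↔ (a, s) ∈ T.partialBehavior {m, m + 1} := by
  rw [mem_partialBehavior_pair]
  have hm : ∀ k < n, m + 2 + (k : ZMod n) = m ↔ k + 2 = n := fun k hk => by
    simpa using add_natCast_add_natCast_eq_self_iff m hk two_pos hn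
  constructor
  · intro h j hj hj'
    obtain ⟨k, hk, rfl⟩ := exists_eq_add_natCast (m + 2) j
    rw [Ne, hm k hk] at hj
    rw [Ne, add_two_add_natCast_eq_add_one_iff m hk] at hj'
    exact h k (by omega)
  · intro h k hk
    exact h _ ((hm k (by omega)).not.2 (by omega))
      ((add_two_add_natCast_eq_add_one_iff m (by omega)).not.2 (by omega))

theorem isSpanTwoObservable_iff [NeZero n] (hn : 2 ≤ n) :
    T.IsSpanTwoObservable ↔ ∀ m s, (0, s) ∈ T.partialBehavior {m, m + 1} →
      ∀ j, j ≠ m + 1 → s j = 0 := by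
  have hstates : ∀ (m : ZMod n) (s : ∀ j, T.S j),
      (∀ k ≤ n - 2, s (m + 2 + (k : ZMod n)) = 0) ↔ ∀ j, j ≠ m + 1 → s j = 0 := by
    intro m s
    constructor
    · intro h j hj
      obtain ⟨k, hk, rfl⟩ := exists_eq_add_natCast (m + 2) j
      rw [Ne, add_two_add_natCast_eq_add_one_iff m hk] at hj
      exact h k (by omega)
    · exact fun h k hk =>
        h _ ((add_two_add_natCast_eq_add_one_iff m (by omega)).not.2 (by omega))
  simp only [← hstates, ← isPath_iff_mem_partialBehavior hn]
  exact ⟨fun h m => h (m + 2), fun h i => sub_add_cancel i 2 ▸ h (i - 2)⟩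

end Paths

section Dual

variable {T : Trellis F n}

theorem mem_dual_C {j : ZMod n} {g : Module.Dual F (T.S j)} {b : F}
    {h : Module.Dual F (T.S (j + 1))} :
    (g, b, h) ∈ T.dual.C j ↔ ∀ s a s', (s, a, s') ∈ T.C j → g s + b * a - h s' = 0 :=
  ⟨fun H s a s' hx => H (s, a, s') hx, fun H x hx => H x.1 x.2.1 x.2.2 hx⟩

theorem mem_dual_C_iff_branchPairing_mem {j : ZMod n}
    {y : Module.Dual F (T.S j) × F × Module.Dual F (T.S (j + 1))} :
    y ∈ T.dual.C j ↔ branchPairing F (T.S j) (T.S (j + 1)) y ∈ (T.C j).dualAnnihilator := by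
  simp only [Submodule.mem_dualAnnihilator, branchPairing_apply]
  rfl

theorem finrank_dual_S (T : Trellis F n) (j : ZMod n) :
    Module.finrank F (T.dual.S j) = Module.finrank F (T.S j) :=
  Subspace.dual_finrank_eq

theorem finrank_dual_C (T : Trellis F n) (j : ZMod n) :
    Module.finrank F (T.dual.C j) + Module.finrank F (T.C j) =
      Module.finrank F (T.S j) + 1 + Module.finrank F (T.S (j + 1)) := by
  let e : (T.dual.S j × F × T.dual.S (j + 1)) ≃ₗ[F] Module.Dual F (T.S j × F × T.S (j + 1)) :=
    branchPairing F (T.S j) (T.S (j + 1))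
  have hcomap : T.dual.C j = (T.C j).dualAnnihilator.comap e.toLinearMap :=
    Submodule.ext fun _ => mem_dual_C_iff_branchPairing_mem
  have hequiv := (LinearEquiv.ofSubmodule' e (T.C j).dualAnnihilator).finrank_eq
  have hsum := Subspace.finrank_add_finrank_dualAnnihilator_eq (T.C j)
  rw [← hcomap] at hequiv
  rw [Module.finrank_prod, Module.finrank_prod, Module.finrank_self] at hsum
  omega

theorem exists_dual_branches [NeZero n] (A : Set (ZMod n))
    {l : Module.Dual F ((ZMod n → F) × ∀ j, T.S j)} (hl : ∀ p ∈ T.partialBehavior A, l p = 0) :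
    ∃ (g : ∀ j, Module.Dual F (T.S j)) (b : ZMod n → F) (h : ∀ j, Module.Dual F (T.S (j + 1))),
      (∀ j, (g j, b j, h j) ∈ T.dual.C j) ∧ (∀ j ∈ A, g j = 0 ∧ h j = 0) ∧
      (∀ j, l (Pi.single j 1, 0) = b j) ∧
      ∀ j x, l (0, Pi.single (j + 1) x) = g (j + 1) x - h j x := by
  classical
  obtain ⟨ω, hω, hlω⟩ := exists_dualAnnihilator_sum_eq
    (fun j => (LinearMap.proj j ∘ₗ LinearMap.snd F (ZMod n → F) (∀ j, T.S j)).prod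
      ((LinearMap.proj j ∘ₗ LinearMap.fst F (ZMod n → F) (∀ j, T.S j)).prod
        (LinearMap.proj (j + 1) ∘ₗ LinearMap.snd F (ZMod n → F) (∀ j, T.S j))))
    (fun j => if j ∈ A then ⊤ else T.C j)
    (fun p hp => hl p fun j hj => by
      have hpj := hp j
      rw [if_neg hj] at hpj
      exact hpj)
  have hωA : ∀ j ∈ A, ω j = 0 := fun j hj => by simpa [if_pos hj] using hω j
  have hωC : ∀ j, ω j ∈ (T.C j).dualAnnihilator := fun j => by
    by_cases hj : j ∈ A
    · exact hωA j hj ▸ Submodule.zero_mem _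
    · simpa only [if_neg hj] using hω j
  let y : ∀ j, Module.Dual F (T.S j) × F × Module.Dual F (T.S (j + 1)) := fun j =>
    (branchPairing F (T.S j) (T.S (j + 1))).symm (ω j)
  have hly : ∀ a s, l (a, s) =
      ∑ j, (y j).1 (s j) + ∑ j, (y j).2.1 * a j - ∑ j, (y j).2.2 (s (j + 1)) := by
    intro a s
    rw [hlω, ← Finset.sum_add_distrib, ← Finset.sum_sub_distrib]
    refine Finset.sum_congr rfl fun j _ => ?_
    rw [← branchPairing_apply (y j) (s j, a j, s (j + 1)), LinearEquiv.apply_symm_apply]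
    rfl
  refine ⟨fun j => (y j).1, fun j => (y j).2.1, fun j => (y j).2.2, fun j => ?_, fun j hj => ?_,
    fun j => ?_, fun j x => ?_⟩
  · exact mem_dual_C_iff_branchPairing_mem.2 (by simpa [y] using hωC j)
  · simp [y, hωA j hj]
  · simp [hly, Pi.single_apply]
  · rw [hly, Fintype.sum_eq_single (j + 1) fun k hk => by rw [Pi.single_eq_of_ne hk, map_zero],
      Fintype.sum_eq_single (f := fun k => (y k).2.2 (Pi.single (M := T.S) (j + 1) x (k + 1))) j
        fun k hk => by rw [Pi.single_eq_of_ne (add_left_injective 1 |>.ne hk), map_zero]]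
    simp

theorem code_dual [NeZero n] (T : Trellis F n) : T.dual.code = dualCode T.code := by
  ext b
  constructor
  · intro hb a ha
    obtain ⟨γ, hγ⟩ := mem_code.1 hb
    obtain ⟨s, hs⟩ := mem_code.1 ha
    change ∀ j, Module.Dual F (T.S j) at γ
    have hterm : ∀ j, a j * b j = -(γ j (s j) - γ (j + 1) (s (j + 1))) := fun j => by
      linear_combination mem_dual_C.1 (hγ j) _ _ _ (hs j)
    rw [Finset.sum_congr rfl fun j _ => hterm j, Finset.sum_neg_distrib,
      sum_sub_add_one_eq_zero fun j => γ j (s j), neg_zero]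
  · intro hb
    let l : Module.Dual F ((ZMod n → F) × ∀ j, T.S j) :=
      (∑ j, b j • (LinearMap.proj j : (ZMod n → F) →ₗ[F] F)) ∘ₗ LinearMap.fst F _ _
    have hl : ∀ a s, l (a, s) = ∑ j, a j * b j := fun a s => by simp [l, mul_comm]
    obtain ⟨g, c, h, hy, -, hc, hgh⟩ := T.exists_dual_branches (A := ∅) (l := l) fun p hp =>
      (hl p.1 p.2).trans (hb p.1 ⟨p, fun j => hp j (Set.notMem_empty j), rfl⟩)
    obtain rfl : b = c := funext fun j => by simpa [hl, Pi.single_apply] using hc j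
    have hhg : ∀ j, h j = g (j + 1) := fun j => LinearMap.ext fun x => by
      exact (sub_eq_zero.1 (by simpa [hl] using (hgh j x).symm)).symm
    exact mem_code.2 ⟨g, fun j => (hhg j ▸ hy j :)⟩

end Dual

end Trellis

theorem eq_map_branch_iff {F V V' W W' : Type*} [Field F]
    [AddCommGroup V] [Module F V] [AddCommGroup V'] [Module F V']
    [AddCommGroup W] [Module F W] [AddCommGroup W'] [Module F W']
    {C : Submodule F (V × F × W)} {C' : Submodule F (V' × F × W')}
    {e : V ≃ₗ[F] V'} {f : W ≃ₗ[F] W'} :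
    C' = C.map (e.prodCongr ((LinearEquiv.refl F F).prodCongr f)).toLinearMap ↔
      ∀ s a s', (s, a, s') ∈ C ↔ (e s, a, f s') ∈ C' := by
  constructor
  · rintro rfl s a s'
    rw [Submodule.mem_map_equiv]
    simp
  · intro h
    ext ⟨s, a, s'⟩
    rw [Submodule.mem_map_equiv]
    simpa using (h (e.symm s) a (f.symm s')).symm

namespace Trellis

variable {F : Type u} [Field F] {n : ℕ}

section Isomorphism

variable {T T' : Trellis F n}

theorem isIsomorphic_iff :
    IsIsomorphic T T' ↔ ∃ φ : ∀ i, T.S i ≃ₗ[F] T'.S i, ∀ i s a s',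
      (s, a, s') ∈ T.C i ↔ (φ i s, a, φ (i + 1) s') ∈ T'.C i :=
  exists_congr fun _ => forall_congr' fun _ => eq_map_branch_iff

theorem IsIsomorphic.refl (T : Trellis F n) : IsIsomorphic T T :=
  isIsomorphic_iff.2 ⟨fun _ => LinearEquiv.refl F _, fun _ _ _ _ => Iff.rfl⟩

theorem IsIsomorphic.symm (h : IsIsomorphic T T') : IsIsomorphic T' T := by
  obtain ⟨φ, hφ⟩ := isIsomorphic_iff.1 h
  refine isIsomorphic_iff.2 ⟨fun i => (φ i).symm, fun i s a s' => ?_⟩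
  rw [hφ, LinearEquiv.apply_symm_apply, LinearEquiv.apply_symm_apply]

theorem IsIsomorphic.code_le (h : IsIsomorphic T T') : T.code ≤ T'.code := by
  obtain ⟨φ, hφ⟩ := isIsomorphic_iff.1 h
  intro a ha
  obtain ⟨s, hs⟩ := mem_code.1 ha
  exact mem_code.2 ⟨fun i => φ i (s i), fun i => (hφ i _ _ _).1 (hs i)⟩

theorem IsIsomorphic.code_eq (h : IsIsomorphic T T') : T.code = T'.code :=
  le_antisymm h.code_le h.symm.code_le

theorem IsIsomorphic.finrank_S (h : IsIsomorphic T T') (i : ZMod n) :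
    Module.finrank F (T.S i) = Module.finrank F (T'.S i) :=
  let ⟨φ, _⟩ := h
  (φ i).finrank_eq

theorem IsIsomorphic.finrank_C (h : IsIsomorphic T T') (i : ZMod n) :
    Module.finrank F (T.C i) = Module.finrank F (T'.C i) := by
  obtain ⟨φ, hφ⟩ := h
  rw [hφ i]
  exact (LinearEquiv.finrank_map_eq _ _).symm

theorem IsIsomorphic.isSpanTwoObservable [NeZero n] (hn : 2 ≤ n) (h : IsIsomorphic T T')
    (hT : T.IsSpanTwoObservable) : T'.IsSpanTwoObservable := by
  rw [isSpanTwoObservable_iff hn] at hT ⊢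
  obtain ⟨φ, hφ⟩ := isIsomorphic_iff.1 h.symm
  intro m s hs j hj
  have hzero := hT m (fun j => φ j (s j)) (fun j hj => (hφ _ _ _ _).1 (hs j hj)) j hj
  exact (LinearEquiv.map_eq_zero_iff _).1 hzero

theorem isIsomorphic_dual_dual (T : Trellis F n) : IsIsomorphic T T.dual.dual := by
  refine isIsomorphic_iff.2 ⟨fun i => Module.evalEquiv F (T.S i), fun i s a s' => ?_⟩
  rw [← Subspace.forall_mem_dualAnnihilator_apply_eq_zero_iff (T.C i),
    (branchPairing F (T.S i) (T.S (i + 1))).surjective.forall]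
  refine forall_congr' fun y => imp_congr mem_dual_C_iff_branchPairing_mem.symm ?_
  rw [branchPairing_apply, mul_comm]
  rfl

theorem isSpanTwoControllable_dual_iff [NeZero n] (hn : 2 ≤ n) :
    T.dual.IsSpanTwoControllable ↔ T.IsSpanTwoObservable :=
  ⟨T.isIsomorphic_dual_dual.symm.isSpanTwoObservable hn,
    T.isIsomorphic_dual_dual.isSpanTwoObservable hn⟩

end Isomorphism

section LocalReduction

variable {T T' : Trellis F n} {i : ZMod n}

theorem isLocalReductionAt_iff :
    IsLocalReductionAt i T T' ↔
      Module.finrank F (T'.S i) ≤ Module.finrank F (T.S i) ∧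
      Module.finrank F (T'.C (i - 1)) ≤ Module.finrank F (T.C (i - 1)) ∧
      Module.finrank F (T'.C i) ≤ Module.finrank F (T.C i) ∧
      (∃ e : ∀ j, j ≠ i → (T.S j ≃ₗ[F] T'.S j), ∀ (j : ZMod n) (h : j ≠ i) (h' : j + 1 ≠ i),
        ∀ s a s', (s, a, s') ∈ T.C j ↔ (e j h s, a, e (j + 1) h' s') ∈ T'.C j) ∧
      T'.code = T.code := by
  simp only [IsLocalReductionAt, eq_map_branch_iff]

theorem IsLocalReductionAt.congr {T₀ T₃ : Trellis F n} (h : IsLocalReductionAt i T T')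
    (h₀ : IsIsomorphic T₀ T) (h₃ : IsIsomorphic T' T₃) : IsLocalReductionAt i T₀ T₃ := by
  obtain ⟨hS, hC, hC', ⟨e, he⟩, hcode⟩ := isLocalReductionAt_iff.1 h
  rw [← h₀.finrank_S, h₃.finrank_S] at hS
  rw [← h₀.finrank_C, h₃.finrank_C] at hC hC'
  refine isLocalReductionAt_iff.2
    ⟨hS, hC, hC', ?_, h₃.code_eq.symm.trans (hcode.trans h₀.code_eq.symm)⟩
  obtain ⟨φ, hφ⟩ := isIsomorphic_iff.1 h₀
  obtain ⟨ψ, hψ⟩ := isIsomorphic_iff.1 h₃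
  refine ⟨fun j hj => (φ j).trans ((e j hj).trans (ψ j)), fun j hj hj' s a s' => ?_⟩
  rw [hφ, he j hj hj', hψ]
  rfl

theorem IsStrictLocalReductionAt.congr {T₀ T₃ : Trellis F n}
    (h : IsStrictLocalReductionAt i T T') (h₀ : IsIsomorphic T₀ T) (h₃ : IsIsomorphic T' T₃) :
    IsStrictLocalReductionAt i T₀ T₃ :=
  ⟨h.1.congr h₀ h₃, by rw [h₀.finrank_S, ← h₃.finrank_S]; exact h.2⟩

theorem IsStrictLocalReductionAt.not_isLocallyIrreducible (h : IsStrictLocalReductionAt i T T') :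
    ¬ T.IsLocallyIrreducible :=
  fun hirr => h.2.ne' ((hirr i T' h.1).finrank_S i)

variable [NeZero n]

theorem IsLocalReductionAt.dual (h : IsLocalReductionAt i T T')
    (hC : ∀ j, Module.finrank F (T'.dual.C j) ≤ Module.finrank F (T.dual.C j)) :
    IsLocalReductionAt i T.dual T'.dual := by
  obtain ⟨hS, -, -, ⟨e, he⟩, hcode⟩ := isLocalReductionAt_iff.1 h
  refine isLocalReductionAt_iff.2
    ⟨by rwa [finrank_dual_S, finrank_dual_S], hC _, hC _, ?_, by rw [code_dual, code_dual, hcode]⟩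
  refine ⟨fun j hj => (e j hj).symm.dualMap, fun j hj hj' g b k => ?_⟩
  change Module.Dual F (T.S j) at g
  change Module.Dual F (T.S (j + 1)) at k
  change (g, b, k) ∈ T.dual.C j ↔
    ((e j hj).symm.dualMap g, b, (e (j + 1) hj').symm.dualMap k) ∈ T'.dual.C j
  refine mem_dual_C.trans (Iff.trans ?_ mem_dual_C.symm)
  rw [(e j hj).surjective.forall]
  refine forall_congr' fun s => forall_congr' fun a => ?_
  rw [(e (j + 1) hj').surjective.forall]
  refine forall_congr' fun s' => ?_
  simp only [← he j hj hj', LinearEquiv.dualMap_apply, LinearEquiv.symm_apply_apply]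

end LocalReduction

/-- `T'` is a local reduction of `T` at time `i` and `T'°` is one of `T°`. -/
def IsBireductionAt (i : ZMod n) (T T' : Trellis F n) : Prop :=
  IsLocalReductionAt i T T' ∧ IsLocalReductionAt i T.dual T'.dual

/-- `T'` is a strict local reduction of `T` at time `i` and `T'°` is one of `T°`. -/
def IsStrictBireductionAt (i : ZMod n) (T T' : Trellis F n) : Prop :=
  IsStrictLocalReductionAt i T T' ∧ IsStrictLocalReductionAt i T.dual T'.dual

/-- `T` and `T°` can be reduced simultaneously, with a strict last step, in one or two steps. -/
def IsBireducible (T : Trellis F n) : Prop :=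
  (∃ i T', IsStrictBireductionAt i T T') ∨
    ∃ i T', IsBireductionAt i T T' ∧ ∃ j T'', IsStrictBireductionAt j T' T''

section Bireduction

variable {T T' : Trellis F n} {i : ZMod n}

theorem IsBireductionAt.of_dual (h : IsBireductionAt i T.dual T') :
    IsBireductionAt i T T'.dual :=
  ⟨h.2.congr T.isIsomorphic_dual_dual (.refl _), h.1.congr (.refl _) T'.isIsomorphic_dual_dual⟩

theorem IsStrictBireductionAt.of_dual (h : IsStrictBireductionAt i T.dual T') :
    IsStrictBireductionAt i T T'.dual :=
  ⟨h.2.congr T.isIsomorphic_dual_dual (.refl _), h.1.congr (.refl _) T'.isIsomorphic_dual_dual⟩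

theorem IsStrictBireductionAt.dual (h : IsStrictBireductionAt i T T') :
    IsStrictBireductionAt i T.dual T'.dual :=
  ⟨h.2, h.1.congr T.isIsomorphic_dual_dual.symm T'.isIsomorphic_dual_dual⟩

theorem IsBireducible.of_dual (h : T.dual.IsBireducible) : T.IsBireducible := by
  rcases h with ⟨i, R, hR⟩ | ⟨i, R, hR, j, R', hR'⟩
  · exact Or.inl ⟨i, R.dual, hR.of_dual⟩
  · exact Or.inr ⟨i, R.dual, hR.of_dual, j, R'.dual, hR'.dual⟩

theorem IsBireducible.not_isLocallyIrreducible (h : T.IsBireducible) :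
    ¬ T.IsLocallyIrreducible := by
  rcases h with ⟨i, T', h⟩ | ⟨i, T', h, j, T'', h'⟩
  · exact h.1.not_isLocallyIrreducible
  · exact fun hirr =>
      (h'.1.congr (hirr i T' h.1) (.refl _)).not_isLocallyIrreducible hirr

variable [NeZero n]

theorem isBireductionAt_of_eq_comap
    (f : ∀ j, (T'.S j × F × T'.S (j + 1)) →ₗ[F] (T.S j × F × T.S (j + 1)))
    (hinj : ∀ j, Function.Injective (f j)) (hf : ∀ j, T'.C j = (T.C j).comap (f j))
    (hS : Module.finrank F (T'.S i) ≤ Module.finrank F (T.S i))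
    (he : ∃ e : ∀ j, j ≠ i → (T.S j ≃ₗ[F] T'.S j), ∀ (j : ZMod n) (h : j ≠ i) (h' : j + 1 ≠ i),
      ∀ s a s', (s, a, s') ∈ T.C j ↔ (e j h s, a, e (j + 1) h' s') ∈ T'.C j)
    (hcode : T'.code = T.code) : IsBireductionAt i T T' := by
  have hC : ∀ j, Module.finrank F (T'.C j) ≤ Module.finrank F (T.C j) := fun j =>
    hf j ▸ finrank_comap_le_of_injective (hinj j) (T.C j)
  have hdual : ∀ j, Module.finrank F (T'.dual.C j) ≤ Module.finrank F (T.dual.C j) := by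
    intro j
    have hsum := T.finrank_dual_C j
    have hsum' := T'.finrank_dual_C j
    have hcomap := finrank_add_finrank_le_finrank_comap_add (f j) (T.C j)
    rw [← hf j] at hcomap
    simp only [Module.finrank_prod, Module.finrank_self] at hcomap
    omega
  have h : IsLocalReductionAt i T T' := isLocalReductionAt_iff.2 ⟨hS, hC _, hC _, he, hcode⟩
  exact ⟨h, h.dual hdual⟩

end Bireduction

section Trim

/-- The states at time `j` that lie on valid trajectories. -/
def trimStates (T : Trellis F n) (j : ZMod n) : Submodule F (T.S j) :=
  T.behavior.map (LinearMap.proj j ∘ₗ LinearMap.snd F (ZMod n → F) (∀ i, T.S i))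

/-- The trellis obtained by restricting the states at each time `j` to the subspace `V j`. -/
def restrictStates (T : Trellis F n) (V : ∀ j, Submodule F (T.S j)) : Trellis F n where
  S j := V j
  C j := (T.C j).comap ((V j).subtype.prodMap (LinearMap.id.prodMap (V (j + 1)).subtype))

variable {T : Trellis F n}

theorem isStateTrim_iff : T.IsStateTrim ↔ ∀ j, T.trimStates j = ⊤ :=
  forall_congr' fun j => (Submodule.eq_top_iff' (p := T.trimStates j)).symm

theorem code_restrictStates {V : ∀ j, Submodule F (T.S j)} (hV : ∀ j, T.trimStates j ≤ V j) :
    (T.restrictStates V).code = T.code := by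
  ext a
  rw [mem_code, mem_code]
  constructor
  · rintro ⟨s, hs⟩
    change ∀ j, V j at s
    exact ⟨fun j => s j, fun j => hs j⟩
  · rintro ⟨s, hs⟩
    exact ⟨fun j => ⟨s j, hV j ⟨(a, s), hs, rfl⟩⟩, fun j => hs j⟩

variable [NeZero n]

theorem isBireductionAt_restrictStates {V : ∀ j, Submodule F (T.S j)} {i : ZMod n}
    (hV : ∀ j, T.trimStates j ≤ V j) (htop : ∀ j, j ≠ i → V j = ⊤) :
    IsBireductionAt i T (T.restrictStates V) :=
  isBireductionAt_of_eq_comap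
    (fun j => (V j).subtype.prodMap (LinearMap.id.prodMap (V (j + 1)).subtype))
    (fun j => (V j).injective_subtype.prodMap
      (Function.injective_id.prodMap (V (j + 1)).injective_subtype))
    (fun _ => rfl) (Submodule.finrank_le (V i))
    ⟨fun j hj => (LinearEquiv.ofTop (V j) (htop j hj)).symm, fun _ _ _ _ _ _ => Iff.rfl⟩
    (code_restrictStates hV)

theorem exists_isStrictBireductionAt_of_not_isStateTrim (hT : ¬ T.IsStateTrim) :
    ∃ i T', IsStrictBireductionAt i T T' := by
  classical
  rw [isStateTrim_iff] at hT
  push Not at hT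
  obtain ⟨i, hi⟩ := hT
  let V : ∀ j, Submodule F (T.S j) := Function.update (fun _ => ⊤) i (T.trimStates i)
  have hVi : V i = T.trimStates i := Function.update_self ..
  have htop : ∀ j, j ≠ i → V j = ⊤ := fun j hj => Function.update_of_ne hj ..
  have hV : ∀ j, T.trimStates j ≤ V j := by
    intro j
    by_cases hj : j = i
    · rw [hj, hVi]
    · exact (htop j hj).symm ▸ le_top
  have hlt : Module.finrank F (V i) < Module.finrank F (T.S i) :=
    hVi ▸ Submodule.finrank_lt hi
  have hred := isBireductionAt_restrictStates hV htop
  refine ⟨i, T.restrictStates V, ⟨hred.1, hlt⟩, hred.2, ?_⟩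
  rw [finrank_dual_S, finrank_dual_S]
  exact hlt

theorem exists_isStrictBireductionAt_of_not_isStateTrim_and
    (hT : ¬ (T.IsStateTrim ∧ T.dual.IsStateTrim)) : ∃ i T', IsStrictBireductionAt i T T' := by
  by_cases htrim : T.IsStateTrim
  · obtain ⟨i, T', h⟩ :=
      exists_isStrictBireductionAt_of_not_isStateTrim fun hdual => hT ⟨htrim, hdual⟩
    exact ⟨i, T'.dual, h.of_dual⟩
  · exact exists_isStrictBireductionAt_of_not_isStateTrim htrim

-- Along any valid trajectory `γ` of the dual trellis, `γ j (x j)` does not depend on `j`.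
theorem eq_zero_of_dual_isStateTrim (hdual : T.dual.IsStateTrim) {m k : ZMod n}
    {x : ∀ j, T.S j} (hx : (0, x) ∈ T.partialBehavior {m}) (hk : x k = 0) : x = 0 := by
  funext j
  refine (Module.forall_dual_apply_eq_zero_iff F (x j)).1 fun g => ?_
  obtain ⟨⟨b, γ⟩, hγ, rfl⟩ := hdual j g
  change ∀ j, Module.Dual F (T.S j) at γ
  have hstep : ∀ j, j ≠ m → γ (j + 1) (x (j + 1)) = γ j (x j) := by
    intro j hj
    have h := mem_dual_C.1 (hγ j) _ _ _ (hx j hj)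
    change γ j (x j) + b j * 0 - γ (j + 1) (x (j + 1)) = 0 at h
    linear_combination -h
  change γ j (x j) = 0
  rw [eq_of_forall_ne_apply_add_one_eq (f := fun j => γ j (x j)) hstep j k, hk, map_zero]

theorem isProper_of_dual_isStateTrim (hn : 2 ≤ n) (hdual : T.dual.IsStateTrim) : T.IsProper := by
  intro i
  constructor
  · intro s hs
    obtain ⟨k, rfl⟩ : ∃ k, i = k + 1 := ⟨i - 1, (sub_add_cancel i 1).symm⟩
    have hx : (0, Pi.single (k + 1) s) ∈ T.partialBehavior {k} := by
      refine mem_partialBehavior.2 fun j hj => ?_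
      by_cases hj' : j = k + 1
      · subst hj'
        rwa [Pi.single_eq_same, Pi.single_eq_of_ne (add_one_ne_self_of_two_le hn _)]
      · rw [Pi.single_eq_of_ne hj', Pi.single_eq_of_ne fun h => hj (add_right_cancel h)]
        exact (T.C j).zero_mem
    exact Pi.single_eq_zero_iff.1 (eq_zero_of_dual_isStateTrim hdual hx
      (Pi.single_eq_of_ne (add_one_ne_self_of_two_le hn k).symm s))
  · intro s' hs'
    have hx : (0, Pi.single (i + 1) s') ∈ T.partialBehavior {i + 1} := by
      refine mem_partialBehavior.2 fun j hj => ?_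
      rw [Pi.single_eq_of_ne hj]
      by_cases hj' : j = i
      · subst hj'
        rwa [Pi.single_eq_same]
      · rw [Pi.single_eq_of_ne fun h => hj' (add_right_cancel h)]
        exact (T.C j).zero_mem
    exact Pi.single_eq_zero_iff.1 (eq_zero_of_dual_isStateTrim hdual hx
      (Pi.single_eq_of_ne (add_one_ne_self_of_two_le hn i).symm s'))

end Trim

end Trellis

/-- The linear map `(s, a, s') ↦ (s + φ' s' • z, a, s' + φ s • z')`, which adds to the states of a
branch multiples of fixed states `z`, `z'`. -/
def shearMap {F V W : Type*} [Field F] [AddCommGroup V] [Module F V] [AddCommGroup W] [Module F W]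
    (φ : Module.Dual F V) (φ' : Module.Dual F W) (z : V) (z' : W) :
    (V × F × W) →ₗ[F] (V × F × W) :=
  LinearMap.id + (φ'.smulRight z ∘ₗ LinearMap.snd F F W ∘ₗ LinearMap.snd F V (F × W)).prod
    ((0 : (V × F × W) →ₗ[F] F).prod (φ.smulRight z' ∘ₗ LinearMap.fst F V (F × W)))

theorem shearMap_apply {F V W : Type*} [Field F] [AddCommGroup V] [Module F V] [AddCommGroup W]
    [Module F W] (φ : Module.Dual F V) (φ' : Module.Dual F W) (z s : V) (z' s' : W) (a : F) :
    shearMap φ φ' z z' (s, a, s') = (s + φ' s' • z, a, s' + φ s • z') := by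
  simp [shearMap]

theorem shearMap_injective {F V W : Type*} [Field F] [AddCommGroup V] [Module F V]
    [AddCommGroup W] [Module F W] {φ : Module.Dual F V} {φ' : Module.Dual F W} {z : V} {z' : W}
    (hφ : φ z = 0) : Function.Injective (shearMap φ φ' z z') := by
  rw [injective_iff_map_eq_zero]
  rintro ⟨s, a, s'⟩ h
  rw [shearMap_apply, Prod.mk_eq_zero, Prod.mk_eq_zero] at h
  obtain ⟨hs, rfl, hs'⟩ := h
  have hφs : φ s = 0 := by simpa [hφ] using congrArg φ hs
  obtain rfl : s' = 0 := by simpa [hφs] using hs'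
  obtain rfl : s = 0 := by simpa using hs
  rfl

theorem NoSpanTwoCodeword.eq_zero_of_forall_ne {F : Type u} [Field F] {n : ℕ}
    {C : Submodule F (ZMod n → F)} (hC : NoSpanTwoCodeword C) {c : ZMod n → F} (hc : c ∈ C)
    {m : ZMod n} (h : ∀ j, j ≠ m → j ≠ m + 1 → c j = 0) : c = 0 := by
  refine hC c hc m 2 le_rfl fun j hj => ?_
  by_cases hjm : j = m
  · exact ⟨0, by norm_num, by simpa using hjm⟩
  · exact ⟨1, by norm_num, by simpa using not_not.1 fun hj' => hj (h j hjm hj')⟩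

namespace Trellis

variable {F : Type u} [Field F] {n : ℕ}

/-- The trellis whose valid trajectories are those of `T` with the state sequence `s` replaced by
`s - φ (s (m + 1)) • z`, provided that `z (m + 1) = 0` and that `z` is a path with all symbols `0`
outside the times `m` and `m + 1`. -/
def shear (T : Trellis F n) (m : ZMod n) (z : ∀ j, T.S j) (φ : Module.Dual F (T.S (m + 1))) :
    Trellis F n where
  S := T.S
  C j := (T.C j).comap (shearMap (Pi.single (M := fun j => Module.Dual F (T.S j)) (m + 1) φ j)
    (Pi.single (M := fun j => Module.Dual F (T.S j)) (m + 1) φ (j + 1)) (z j) (z (j + 1)))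

section Shear

variable {T : Trellis F n} {m : ZMod n} {z : ∀ j, T.S j} {φ : Module.Dual F (T.S (m + 1))}
  {a : F}

theorem mem_shear_C_left (hz : z (m + 1) = 0) {s : T.S m} {s' : T.S (m + 1)} :
    (s, a, s') ∈ (T.shear m z φ).C m ↔ (s + φ s' • z m, a, s') ∈ T.C m := by
  change shearMap _ _ _ _ (s, a, s') ∈ T.C m ↔ _
  rw [shearMap_apply, hz, smul_zero, add_zero, Pi.single_eq_same]

theorem mem_shear_C_right (hz : z (m + 1) = 0) {s : T.S (m + 1)} {s' : T.S (m + 1 + 1)} :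
    (s, a, s') ∈ (T.shear m z φ).C (m + 1) ↔
      (s, a, s' + φ s • z (m + 1 + 1)) ∈ T.C (m + 1) := by
  change shearMap _ _ _ _ (s, a, s') ∈ T.C (m + 1) ↔ _
  rw [shearMap_apply, hz, smul_zero, add_zero, Pi.single_eq_same]

theorem mem_shear_C_of_ne {j : ZMod n} (hj : j ≠ m) (hj' : j ≠ m + 1) {s : T.S j}
    {s' : T.S (j + 1)} : (s, a, s') ∈ (T.shear m z φ).C j ↔ (s, a, s') ∈ T.C j := by
  change shearMap _ _ _ _ (s, a, s') ∈ T.C j ↔ _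
  rw [shearMap_apply, Pi.single_eq_of_ne hj', Pi.single_eq_of_ne fun h => hj (add_right_cancel h)]
  simp only [LinearMap.zero_apply, zero_smul, add_zero]

theorem mem_shear_behavior_iff (hz : z (m + 1) = 0)
    (hz' : (0, z) ∈ T.partialBehavior {m, m + 1}) {a : ZMod n → F} {s : ∀ j, T.S j} :
    (a, s) ∈ (T.shear m z φ).behavior ↔ (a, s + φ (s (m + 1)) • z) ∈ T.behavior := by
  have hsum := Submodule.add_mem_iff_left (T.partialBehavior {m, m + 1}) (x := (a, s))
    (Submodule.smul_mem _ (φ (s (m + 1))) hz')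
  simp only [Prod.smul_mk, smul_zero, Prod.mk_add_mk, add_zero] at hsum
  have hpath : (a, s) ∈ (T.shear m z φ).partialBehavior {m, m + 1} ↔
      (a, s) ∈ T.partialBehavior {m, m + 1} :=
    mem_partialBehavior_pair.trans (Iff.trans
      (forall₃_congr fun j hj hj' => mem_shear_C_of_ne hj hj') mem_partialBehavior_pair.symm)
  refine (mem_behavior_iff (m := m)).trans (Iff.trans ?_ (mem_behavior_iff (m := m)).symm)
  refine and_congr (hpath.trans hsum.symm) (and_congr ?_ ?_)
  · refine (mem_shear_C_left hz).trans ?_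
    simp only [Pi.add_apply, Pi.smul_apply, hz, smul_zero, add_zero]
  · refine (mem_shear_C_right hz).trans ?_
    simp only [Pi.add_apply, Pi.smul_apply, hz, smul_zero, add_zero]

theorem code_shear (hz : z (m + 1) = 0) (hz' : (0, z) ∈ T.partialBehavior {m, m + 1}) :
    (T.shear m z φ).code = T.code := by
  ext a
  rw [mem_code, mem_code]
  constructor
  · rintro ⟨s, hs⟩
    exact ⟨_, (mem_shear_behavior_iff hz hz').1 hs⟩
  · rintro ⟨s, hs⟩
    refine ⟨s - φ (s (m + 1)) • z, (mem_shear_behavior_iff hz hz').2 ?_⟩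
    simpa [hz] using hs

variable [NeZero n]

theorem isBireductionAt_shear (hz : z (m + 1) = 0) (hz' : (0, z) ∈ T.partialBehavior {m, m + 1}) :
    IsBireductionAt (m + 1) T (T.shear m z φ) := by
  have hφz : ∀ j, Pi.single (M := fun j => Module.Dual F (T.S j)) (m + 1) φ j (z j) = 0 := by
    intro j
    by_cases hj : j = m + 1
    · subst hj
      rw [hz, map_zero]
    · rw [Pi.single_eq_of_ne hj, LinearMap.zero_apply]
  exact isBireductionAt_of_eq_comap _ (fun j => shearMap_injective (hφz j)) (fun _ => rfl) le_rfl
    ⟨fun j _ => LinearEquiv.refl F (T.S j), fun j hj hj' s a s' =>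
      (mem_shear_C_of_ne (fun h => hj' (congrArg (· + 1) h)) hj).symm⟩ (code_shear hz hz')

end Shear

section Observability

variable [NeZero n] {T : Trellis F n} {m : ZMod n} {z : ∀ j, T.S j} {a : F} {σ : T.S (m + 1)}

theorem exists_not_isStateTrim_shear_left (hn : 2 ≤ n) (hdual : T.dual.IsStateTrim)
    (hz : z (m + 1) = 0) (hz' : (0, z) ∈ T.partialBehavior {m, m + 1}) (hz0 : z ≠ 0)
    (hmem : (z m, a, σ) ∈ T.C m) (hσ : σ ≠ 0) :
    ∃ φ, ¬ ((T.shear m z φ).IsStateTrim ∧ (T.shear m z φ).dual.IsStateTrim) := by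
  have hopen : (z m, 0, 0) ∉ T.C m := by
    refine fun h => hz0 (eq_zero_of_dual_isStateTrim (m := m + 1) hdual ?_ hz)
    refine mem_partialBehavior.2 fun j hj => ?_
    by_cases hjm : j = m
    · subst hjm
      rwa [hz]
    · exact mem_partialBehavior_pair.1 hz' j hjm hj
  obtain ⟨φ, ⟨u, hu⟩ | ⟨y, hy, hmem⟩⟩ := exists_dual_forall_notMem_or_exists_mem
    (isProper_of_dual_isStateTrim hn hdual m).2 hmem hσ hopen
  · refine ⟨φ, fun htrim => ?_⟩
    obtain ⟨p, hp, hpu⟩ := htrim.1 m u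
    exact hu _ _ (hpu ▸ (mem_shear_C_left hz).1 (hp m))
  · refine ⟨φ, fun htrim => hy ((isProper_of_dual_isStateTrim hn htrim.2 m).2 y ?_)⟩
    exact (mem_shear_C_left hz (s := 0)).2 (by rwa [zero_add])

theorem exists_not_isStateTrim_shear_right (hn : 2 ≤ n) (hdual : T.dual.IsStateTrim)
    (hz : z (m + 1) = 0) (hz' : (0, z) ∈ T.partialBehavior {m, m + 1}) (hz0 : z ≠ 0)
    (hmem : (σ, a, z (m + 1 + 1)) ∈ T.C (m + 1)) (hσ : σ ≠ 0) :
    ∃ φ, ¬ ((T.shear m z φ).IsStateTrim ∧ (T.shear m z φ).dual.IsStateTrim) := by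
  have hopen : (0, 0, z (m + 1 + 1)) ∉ T.C (m + 1) := by
    refine fun h => hz0 (eq_zero_of_dual_isStateTrim (m := m) hdual ?_ hz)
    refine mem_partialBehavior.2 fun j hj => ?_
    by_cases hjm : j = m + 1
    · subst hjm
      rwa [hz]
    · exact mem_partialBehavior_pair.1 hz' j hj hjm
  let mirror : (T.S (m + 1 + 1) × F × T.S (m + 1)) →ₗ[F] (T.S (m + 1) × F × T.S (m + 1 + 1)) :=
    (LinearMap.snd F F _ ∘ₗ LinearMap.snd F _ _).prod
      ((LinearMap.fst F F _ ∘ₗ LinearMap.snd F _ _).prod (LinearMap.fst F _ _))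
  obtain ⟨φ, ⟨u, hu⟩ | ⟨y, hy, hmem⟩⟩ := exists_dual_forall_notMem_or_exists_mem
    (D := (T.C (m + 1)).comap mirror)
    (isProper_of_dual_isStateTrim hn hdual (m + 1)).1 hmem hσ hopen
  · refine ⟨φ, fun htrim => ?_⟩
    obtain ⟨p, hp, hpu⟩ := htrim.1 (m + 1 + 1) u
    exact hu _ _ (hpu ▸ (mem_shear_C_right hz).1 (hp (m + 1)))
  · refine ⟨φ, fun htrim => hy ((isProper_of_dual_isStateTrim hn htrim.2 (m + 1)).1 y ?_)⟩
    exact (mem_shear_C_right hz (s' := 0)).2 (by rwa [zero_add])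

theorem eq_zero_of_mem_of_noSpanTwoCodeword (hn : 2 ≤ n) (hC : NoSpanTwoCodeword T.code)
    (hdual : T.dual.IsStateTrim) (hz : z (m + 1) = 0)
    (hz' : (0, z) ∈ T.partialBehavior {m, m + 1}) {b : F} (hmem : (z m, a, 0) ∈ T.C m)
    (hmem' : (0, b, z (m + 1 + 1)) ∈ T.C (m + 1)) : z = 0 := by
  have hc : (Function.update (Function.update (0 : ZMod n → F) m a) (m + 1) b, z) ∈ T.behavior :=
    (update_update_mem_behavior_iff (add_one_ne_self_of_two_le hn m)).2
      ⟨hz', by rwa [hz], by rwa [hz]⟩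
  rw [hC.eq_zero_of_forall_ne (mem_code.2 ⟨z, hc⟩) fun j hj hj' => by
    rw [Function.update_of_ne hj', Function.update_of_ne hj, Pi.zero_apply]] at hc
  exact eq_zero_of_dual_isStateTrim (m := m) hdual (behavior_le_partialBehavior _ hc) hz

theorem isBireducible_of_not_isSpanTwoObservable (hn : 2 ≤ n) (hC : NoSpanTwoCodeword T.code)
    (hT : ¬ T.IsSpanTwoObservable) : T.IsBireducible := by
  by_contra hirr
  have htrim : T.IsStateTrim ∧ T.dual.IsStateTrim := not_not.1 fun h =>
    hirr (Or.inl (exists_isStrictBireductionAt_of_not_isStateTrim_and h))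
  refine hT ((isSpanTwoObservable_iff hn).2 fun m s hs k hk => ?_)
  by_contra hsk
  let z : ∀ j, T.S j := Function.update s (m + 1) 0
  have hz : z (m + 1) = 0 := Function.update_self ..
  have hz' : (0, z) ∈ T.partialBehavior {m, m + 1} :=
    (mem_partialBehavior_pair_congr (fun _ _ _ => rfl) fun j hj => Function.update_of_ne hj ..).2 hs
  have hz0 : z ≠ 0 := fun h =>
    hsk ((Function.update_of_ne hk ..).symm.trans (congrFun h k))
  have hshear : ∀ φ, (T.shear m z φ).IsStateTrim ∧ (T.shear m z φ).dual.IsStateTrim :=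
    fun φ => not_not.1 fun h => hirr (Or.inr ⟨m + 1, T.shear m z φ, isBireductionAt_shear hz hz',
      exists_isStrictBireductionAt_of_not_isStateTrim_and h⟩)
  obtain ⟨p, hp, hpz⟩ := htrim.1 m (z m)
  obtain ⟨q, hq, hqz⟩ := htrim.1 (m + 1 + 1) (z (m + 1 + 1))
  have hmem : (z m, p.1 m, p.2 (m + 1)) ∈ T.C m := hpz ▸ hp m
  have hmem' : (q.2 (m + 1), q.1 (m + 1), z (m + 1 + 1)) ∈ T.C (m + 1) := hqz ▸ hq (m + 1)
  by_cases hσ : p.2 (m + 1) = 0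
  · by_cases hσ' : q.2 (m + 1) = 0
    · rw [hσ] at hmem
      rw [hσ'] at hmem'
      exact hz0 (eq_zero_of_mem_of_noSpanTwoCodeword hn hC htrim.2 hz hz' hmem hmem')
    · obtain ⟨φ, hφ⟩ := exists_not_isStateTrim_shear_right hn htrim.2 hz hz' hz0 hmem' hσ'
      exact hφ (hshear φ)
  · obtain ⟨φ, hφ⟩ := exists_not_isStateTrim_shear_left hn htrim.2 hz hz' hz0 hmem hσ
    exact hφ (hshear φ)

end Observability

section Controllability

variable [NeZero n] {T : Trellis F n} {m : ZMod n}

theorem exists_dual_path (hn : 3 ≤ n) {f : Module.Dual F (T.S m)}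
    {f' : Module.Dual F (T.S (m + 1 + 1))}
    (hf : ∀ a s, (a, s) ∈ T.partialBehavior {m, m + 1} → f (s m) + f' (s (m + 1 + 1)) = 0) :
    ∃ γ : ∀ j, Module.Dual F (T.S j),
      (0, γ) ∈ T.dual.partialBehavior {m, m + 1} ∧ γ m = -f ∧ γ (m + 1 + 1) = f' := by
  obtain ⟨k, rfl⟩ : ∃ k, m = k + 1 := ⟨m - 1, (sub_add_cancel m 1).symm⟩
  have hne := add_one_add_one_ne_self hn (k + 1)
  let l : Module.Dual F ((ZMod n → F) × ∀ j, T.S j) :=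
    (f ∘ₗ LinearMap.proj (k + 1) + f' ∘ₗ LinearMap.proj (k + 1 + 1 + 1)) ∘ₗ LinearMap.snd F _ _
  have hl : ∀ a s, l (a, s) = f (s (k + 1)) + f' (s (k + 1 + 1 + 1)) := fun _ _ => rfl
  obtain ⟨g, b, h, hy, hA, hb, hgh⟩ :=
    T.exists_dual_branches (A := {k + 1, k + 1 + 1}) (l := l) fun p hp => hf p.1 p.2 hp
  have hb0 : ∀ j, b j = 0 := fun j => by simp [← hb, hl]
  have hk : h k = -f := LinearMap.ext fun x => by
    have hx := hgh k x
    rw [hl, (hA (k + 1) (by simp)).1, Pi.single_eq_same, Pi.single_eq_of_ne hne] at hx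
    simpa [neg_eq_iff_eq_neg] using congrArg Neg.neg hx.symm
  have hg : g (k + 1 + 1 + 1) = f' := LinearMap.ext fun x => by
    have hx := hgh (k + 1 + 1) x
    rw [hl, (hA (k + 1 + 1) (by simp)).2, Pi.single_eq_same, Pi.single_eq_of_ne hne.symm] at hx
    simpa using hx.symm
  have hstep : ∀ j, j ≠ k → j ≠ k + 1 + 1 → g (j + 1) = h j := fun j hj hj' =>
    LinearMap.ext fun x => by
      have hx := hgh j x
      rw [hl, Pi.single_eq_of_ne fun e => hj (add_right_cancel e).symm,
        Pi.single_eq_of_ne fun e => hj' (add_right_cancel e).symm] at hx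
      exact sub_eq_zero.1 (by simpa using hx.symm)
  obtain ⟨γ, hγ, hγ'⟩ := exists_pi_extension (i := k + 1) (h k) fun j _ => g j
  refine ⟨γ, mem_partialBehavior_pair.2 fun j hj hj' => ?_, hγ.trans hk, (hγ' _ hne).trans hg⟩
  have hnext : γ (j + 1) = h j := by
    by_cases hjk : j = k
    · exact hjk ▸ hγ
    · rw [hγ' _ fun e => hjk (add_right_cancel e), hstep j hjk hj']
  have hj := hy j
  rwa [hb0, ← hγ' j ‹_›, ← hnext] at hj

theorem IsSpanTwoControllable.exists_path (hn : 3 ≤ n) (hc : T.IsSpanTwoControllable)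
    (v : T.S m) (σ : T.S (m + 1)) (w : T.S (m + 1 + 1)) :
    ∃ a s, (a, s) ∈ T.partialBehavior {m, m + 1} ∧
      s m = v ∧ s (m + 1) = σ ∧ s (m + 1 + 1) = w := by
  have hm := add_one_ne_self_of_two_le (n := n) (by omega)
  let ends : ((ZMod n → F) × ∀ j, T.S j) →ₗ[F] T.S m × T.S (m + 1 + 1) :=
    ((LinearMap.proj m).prod (LinearMap.proj (m + 1 + 1))) ∘ₗ LinearMap.snd F _ _
  have htop : (T.partialBehavior {m, m + 1}).map ends = ⊤ := by
    by_contra hlt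
    obtain ⟨ω, hω0, hω⟩ := Submodule.exists_le_ker_of_lt_top _ (lt_top_iff_ne_top.2 hlt)
    obtain ⟨γ, hγ, hγv, hγw⟩ := exists_dual_path hn (f := ω ∘ₗ LinearMap.inl F _ _)
      (f' := ω ∘ₗ LinearMap.inr F _ _) fun a s hs => by
        have hωs : ω (s m, s (m + 1 + 1)) = 0 := hω (Submodule.mem_map_of_mem (f := ends) hs)
        simpa [← map_add] using hωs
    have hzero := (isSpanTwoObservable_iff (by omega)).1 hc m γ hγ
    refine hω0 (LinearMap.prod_ext ?_ ?_)
    · exact neg_eq_zero.1 (hγv.symm.trans (hzero m (hm m).symm))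
    · exact hγw.symm.trans (hzero (m + 1 + 1) (hm (m + 1)))
  obtain ⟨⟨a, s⟩, hs, hvw⟩ : (v, w) ∈ (T.partialBehavior {m, m + 1}).map ends :=
    htop ▸ Submodule.mem_top
  refine ⟨a, Function.update s (m + 1) σ, ?_, ?_, Function.update_self .., ?_⟩
  · exact (mem_partialBehavior_pair_congr (fun _ _ _ => rfl)
      fun j hj => Function.update_of_ne hj ..).2 hs
  · exact (Function.update_of_ne (hm m).symm ..).trans (congrArg Prod.fst hvw)
  · exact (Function.update_of_ne (hm (m + 1)) ..).trans (congrArg Prod.snd hvw)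

theorem IsSpanTwoControllable.exists_branch_to (hn : 3 ≤ n) (hc : T.IsSpanTwoControllable)
    (σ : T.S (m + 1)) : ∃ s a, (s, a, σ) ∈ T.C m := by
  obtain ⟨a, s, hs, rfl, -⟩ := hc.exists_path hn σ 0 0
  exact ⟨_, _, mem_partialBehavior_pair.1 hs m (add_one_ne_self_of_two_le (by omega) m).symm
    (add_one_add_one_ne_self hn m).symm⟩

theorem IsSpanTwoControllable.exists_branch_from (hn : 3 ≤ n) (hc : T.IsSpanTwoControllable)
    (σ : T.S m) : ∃ a s', (σ, a, s') ∈ T.C m := by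
  obtain ⟨k, rfl⟩ : ∃ k, m = k + 1 + 1 := ⟨m - 1 - 1, by simp⟩
  obtain ⟨a, s, hs, -, -, rfl⟩ := hc.exists_path hn 0 0 σ
  exact ⟨_, _, mem_partialBehavior_pair.1 hs (k + 1 + 1) (add_one_add_one_ne_self hn k)
    (add_one_ne_self_of_two_le (by omega) (k + 1))⟩

theorem IsSpanTwoControllable.isBranchTrim (hn : 3 ≤ n) (hc : T.IsSpanTwoControllable) :
    T.IsBranchTrim := by
  rintro m ⟨s, a, s'⟩ h
  obtain ⟨b, w, hw⟩ := hc.exists_branch_from hn s'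
  obtain ⟨c, x, hx, rfl, rfl, rfl⟩ := hc.exists_path hn s s' w
  have hm := add_one_ne_self_of_two_le (by omega) m
  refine ⟨_, (update_update_mem_behavior_iff hm).2 ⟨hx, h, hw⟩, ?_⟩
  simp only [Function.update_of_ne hm.symm, Function.update_self]

theorem IsSpanTwoControllable.isStateTrim (hn : 3 ≤ n) (hc : T.IsSpanTwoControllable) :
    T.IsStateTrim := by
  intro m s
  obtain ⟨a, s', h⟩ := hc.exists_branch_from hn s
  obtain ⟨p, hp, hps⟩ := hc.isBranchTrim hn m _ h
  exact ⟨p, hp, congrArg Prod.fst hps⟩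

theorem IsSpanTwoObservable.isProper (hn : 3 ≤ n) (ho : T.IsSpanTwoObservable) : T.IsProper :=
  isProper_of_dual_isStateTrim (by omega)
    (((isSpanTwoControllable_dual_iff (by omega)).2 ho).isStateTrim hn)

theorem trim_proper_spanTwo_iff (hn : 3 ≤ n) :
    (T.IsStateTrim ∧ T.IsBranchTrim ∧ T.IsProper ∧
      T.IsSpanTwoObservable ∧ T.IsSpanTwoControllable) ↔
      T.IsSpanTwoObservable ∧ T.IsSpanTwoControllable :=
  ⟨fun h => h.2.2.2, fun h => ⟨h.2.isStateTrim hn, h.2.isBranchTrim hn, h.1.isProper hn, h⟩⟩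

end Controllability

section Irreducibility

variable {T T' : Trellis F n} {m : ZMod n} {a : ZMod n → F} {s : ∀ j, T.S j}
  {e : ∀ j, j ≠ m + 1 → (T.S j ≃ₗ[F] T'.S j)}

theorem update_update_mem_code_iff (hm : m + 1 ≠ m)
    (hobs : ∀ s, (0, s) ∈ T.partialBehavior {m, m + 1} → ∀ j, j ≠ m + 1 → s j = 0)
    (hs : (a, s) ∈ T.partialBehavior {m, m + 1}) {x y : F} :
    Function.update (Function.update a m x) (m + 1) y ∈ T.code ↔
      ∃ σ, (s m, x, σ) ∈ T.C m ∧ (σ, y, s (m + 1 + 1)) ∈ T.C (m + 1) := by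
  have hm' : m + 1 + 1 ≠ m + 1 := fun h => hm (add_right_cancel h)
  simp only [mem_code, update_update_mem_behavior_iff hm]
  constructor
  · rintro ⟨t, ht, htx, hty⟩
    have hst : (0, s - t) ∈ T.partialBehavior {m, m + 1} := by
      simpa using Submodule.sub_mem _ hs ht
    have heq : ∀ j, j ≠ m + 1 → s j = t j := fun j hj => sub_eq_zero.1 (hobs _ hst j hj)
    rw [heq m hm.symm, heq (m + 1 + 1) hm']
    exact ⟨t (m + 1), htx, hty⟩
  · rintro ⟨σ, hx, hy⟩
    refine ⟨Function.update s (m + 1) σ, (mem_partialBehavior_pair_congr (fun _ _ _ => rfl)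
      fun j hj => Function.update_of_ne hj ..).2 hs, ?_⟩
    rw [Function.update_self, Function.update_of_ne hm.symm, Function.update_of_ne hm']
    exact ⟨hx, hy⟩

theorem mem_partialBehavior_pair_iff_of_linearEquiv
    (he : ∀ (j : ZMod n) (h : j ≠ m + 1) (h' : j + 1 ≠ m + 1) s a s',
      (s, a, s') ∈ T.C j ↔ (e j h s, a, e (j + 1) h' s') ∈ T'.C j)
    {s' : ∀ j, T'.S j} (hs : ∀ j h, s' j = e j h (s j)) :
    (a, s) ∈ T.partialBehavior {m, m + 1} ↔ (a, s') ∈ T'.partialBehavior {m, m + 1} := by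
  rw [mem_partialBehavior_pair, mem_partialBehavior_pair]
  refine forall₃_congr fun j hj hj' => ?_
  rw [hs j hj', hs (j + 1) fun h => hj (add_right_cancel h)]
  exact he j hj' _ _ _ _

variable [NeZero n]

theorem exists_state_iff_of_code_eq (hn : 3 ≤ n) (ho : T.IsSpanTwoObservable)
    (hc : T.IsSpanTwoControllable)
    (he : ∀ (j : ZMod n) (h : j ≠ m + 1) (h' : j + 1 ≠ m + 1) s a s',
      (s, a, s') ∈ T.C j ↔ (e j h s, a, e (j + 1) h' s') ∈ T'.C j)
    (hcode : T'.code = T.code) (hm : m ≠ m + 1) (hm' : m + 1 + 1 ≠ m + 1)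
    (v : T.S m) (x y : F) (w : T.S (m + 1 + 1)) :
    (∃ σ, (v, x, σ) ∈ T.C m ∧ (σ, y, w) ∈ T.C (m + 1)) ↔
      ∃ σ, (e m hm v, x, σ) ∈ T'.C m ∧ (σ, y, e (m + 1 + 1) hm' w) ∈ T'.C (m + 1) := by
  have hobs := (isSpanTwoObservable_iff (by omega)).1 ho m
  have hobs' : ∀ s', (0, s') ∈ T'.partialBehavior {m, m + 1} → ∀ j, j ≠ m + 1 → s' j = 0 := by
    intro s' hs' j hj
    obtain ⟨t, -, ht⟩ := exists_pi_extension (i := m + 1) (0 : T.S (m + 1))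
      fun j h => (e j h).symm (s' j)
    have het : ∀ j h, s' j = e j h (t j) := fun j h => by simp [ht j h]
    rw [het j hj, hobs t ((mem_partialBehavior_pair_iff_of_linearEquiv he het).2 hs') j hj,
      map_zero]
  obtain ⟨c, s, hs, rfl, -, rfl⟩ := hc.exists_path hn v 0 w
  obtain ⟨s', -, hs'⟩ := exists_pi_extension (i := m + 1) (0 : T'.S (m + 1))
    fun j h => e j h (s j)
  rw [← update_update_mem_code_iff hm.symm hobs hs, ← hcode, ← hs' m hm,
    ← hs' (m + 1 + 1) hm', ← update_update_mem_code_iff hm.symm hobs'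
      ((mem_partialBehavior_pair_iff_of_linearEquiv he hs').1 hs)]

theorem isLocallyIrreducible_of_spanTwo (hn : 3 ≤ n) (ho : T.IsSpanTwoObservable)
    (hc : T.IsSpanTwoControllable) : T.IsLocallyIrreducible := by
  intro i T' hred
  obtain ⟨hS, -, -, ⟨e, he⟩, hcode⟩ := isLocalReductionAt_iff.1 hred
  obtain ⟨m, rfl⟩ : ∃ m, i = m + 1 := ⟨i - 1, (sub_add_cancel i 1).symm⟩
  have hne := add_one_ne_self_of_two_le (n := n) (by omega)
  have hm : m ≠ m + 1 := (hne m).symm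
  have hm' : m + 1 + 1 ≠ m + 1 := hne (m + 1)
  have hcomp := exists_state_iff_of_code_eq hn ho hc he hcode hm hm'
  have hprop := ho.isProper hn
  obtain ⟨θ, hθ, hθ'⟩ := exists_linearEquiv_of_comp_eq
    (P := T.S m × F) (Q := F × T.S (m + 1 + 1)) (V := T.S (m + 1)) (V' := T'.S (m + 1))
    (A := (T.C m).comap (LinearEquiv.prodAssoc F (T.S m) F (T.S (m + 1))).toLinearMap)
    (B := T.C (m + 1))
    (A' := (T'.C m).comap ((e m hm).toLinearMap.prodMap LinearMap.id ∘ₗ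
      (LinearEquiv.prodAssoc F (T.S m) F (T'.S (m + 1))).toLinearMap))
    (B' := (T'.C (m + 1)).comap
      (LinearMap.id.prodMap (LinearMap.id.prodMap (e (m + 1 + 1) hm').toLinearMap)))
    (fun σ => let ⟨s, a, h⟩ := hc.exists_branch_to hn σ; ⟨(s, a), h⟩)
    (fun σ => let ⟨a, s, h⟩ := hc.exists_branch_from hn σ; ⟨(a, s), h⟩)
    (fun σ h => (hprop m).2 σ h) (fun σ h => (hprop (m + 1)).1 σ h)
    (fun p q => hcomp p.1 p.2 q.1 q.2) hS
  obtain ⟨φ, hφ, hφ'⟩ := exists_pi_extension (α := fun j => T.S j ≃ₗ[F] T'.S j) θ e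
  refine isIsomorphic_iff.2 ⟨φ, fun j s a s' => ?_⟩
  by_cases hj : j = m + 1
  · subst hj
    rw [hφ, hφ' _ hm']
    exact hθ' s (a, s')
  by_cases hj' : j = m
  · subst hj'
    rw [hφ, hφ' _ hm]
    exact hθ (s, a) s'
  · have hj1 : j + 1 ≠ m + 1 := fun h => hj' (add_right_cancel h)
    rw [hφ' _ hj, hφ' _ hj1]
    exact he j hj hj1 s a s'

theorem isBireducible_of_not_spanTwo (hn : 2 ≤ n) (hC : NoSpanTwoCodeword T.code)
    (hC' : NoSpanTwoCodeword T.dual.code)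
    (h : ¬ (T.IsSpanTwoObservable ∧ T.IsSpanTwoControllable)) : T.IsBireducible := by
  rcases not_and_or.1 h with h | h
  · exact isBireducible_of_not_isSpanTwoObservable hn hC h
  · exact (isBireducible_of_not_isSpanTwoObservable hn hC' h).of_dual

theorem isLocallyIrreducible_iff (hn : 3 ≤ n) (hC : NoSpanTwoCodeword T.code)
    (hC' : NoSpanTwoCodeword T.dual.code) :
    T.IsLocallyIrreducible ↔ T.IsSpanTwoObservable ∧ T.IsSpanTwoControllable := by
  refine ⟨fun h => ?_, fun h => isLocallyIrreducible_of_spanTwo hn h.1 h.2⟩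
  by_contra h'
  exact (isBireducible_of_not_spanTwo (by omega) hC hC' h').not_isLocallyIrreducible h

end Irreducibility

end Trellis

theorem three_le_of_noSpanTwoCodeword {F : Type u} [Field F] {n : ℕ} [NeZero n]
    {C : Submodule F (ZMod n → F)} (hC : NoSpanTwoCodeword C)
    (hC' : NoSpanTwoCodeword (dualCode C)) : 3 ≤ n := by
  by_contra hn
  have huniv : ∀ c : ZMod n → F, Function.support c ⊆ circularInterval 0 2 := by
    intro c j _
    obtain ⟨k, hk, h⟩ := exists_eq_add_natCast 0 j
    exact ⟨k, by omega, h⟩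
  have hone : (1 : ZMod n → F) ∈ dualCode C := fun x hx => by
    simp [hC x hx 0 2 le_rfl (huniv x)]
  exact one_ne_zero (congrFun (hC' 1 hone 0 2 le_rfl (huniv 1)) 0)

theorem mainTheorem1_general {F : Type u} [Field F] {n : ℕ} [NeZero n]
    (C : Submodule F (ZMod n → F))
    (hC : NoSpanTwoCodeword C) (hC' : NoSpanTwoCodeword (dualCode C))
    (T : Trellis F n) (hT : T.code = C) :
    List.TFAE
      [T.IsLocallyIrreducible,
       T.IsStateTrim ∧ T.IsBranchTrim ∧ T.IsProper ∧
         T.IsSpanTwoObservable ∧ T.IsSpanTwoControllable,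
       T.dual.IsLocallyIrreducible,
       T.dual.IsStateTrim ∧ T.dual.IsBranchTrim ∧ T.dual.IsProper ∧
         T.dual.IsSpanTwoObservable ∧ T.dual.IsSpanTwoControllable] ∧
    (¬ T.IsLocallyIrreducible →
      (∃ (i : ZMod n) (T' : Trellis F n),
        Trellis.IsStrictLocalReductionAt i T T' ∧
        Trellis.IsStrictLocalReductionAt i T.dual T'.dual) ∨
      (∃ (i j : ZMod n) (T' T'' : Trellis F n),
        (Trellis.IsLocalReductionAt i T T' ∧ Trellis.IsStrictLocalReductionAt j T' T'') ∧
        (Trellis.IsLocalReductionAt i T.dual T'.dual ∧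
          Trellis.IsStrictLocalReductionAt j T'.dual T''.dual))) := by
  have hn : 3 ≤ n := three_le_of_noSpanTwoCodeword hC hC'
  subst hT
  rw [← Trellis.code_dual] at hC'
  have hC'' : NoSpanTwoCodeword T.dual.dual.code := T.isIsomorphic_dual_dual.code_eq ▸ hC
  have hirr := Trellis.isLocallyIrreducible_iff hn hC hC'
  have hirr' := Trellis.isLocallyIrreducible_iff hn hC' hC''
  have hdual : T.dual.IsSpanTwoObservable ∧ T.dual.IsSpanTwoControllable ↔
      T.IsSpanTwoObservable ∧ T.IsSpanTwoControllable := by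
    rw [Trellis.isSpanTwoControllable_dual_iff (by omega), and_comm]
    rfl
  refine ⟨?_, fun h => ?_⟩
  · rw [Trellis.trim_proper_spanTwo_iff hn, Trellis.trim_proper_spanTwo_iff hn, hirr', hdual, hirr]
    simp only [List.tfae_cons_self, List.tfae_singleton]
  · rcases Trellis.isBireducible_of_not_spanTwo (by omega) hC hC' fun h' => h (hirr.2 h') with
      h | ⟨i, T', h, j, T'', h'⟩
    · exact Or.inl h
    · exact Or.inr ⟨i, j, T', T'', ⟨h.1, h'.1⟩, h.2, h'.2⟩

theorem mainTheorem1 {F : Type u} [Field F] [Finite F] {n : ℕ} [NeZero n]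
    (C : Submodule F (ZMod n → F))
    (hC : NoSpanTwoCodeword C) (hC' : NoSpanTwoCodeword (dualCode C))
    (T : Trellis F n) (hT : T.code = C) :
    List.TFAE
      [T.IsLocallyIrreducible,
       T.IsStateTrim ∧ T.IsBranchTrim ∧ T.IsProper ∧
         T.IsSpanTwoObservable ∧ T.IsSpanTwoControllable,
       T.dual.IsLocallyIrreducible,
       T.dual.IsStateTrim ∧ T.dual.IsBranchTrim ∧ T.dual.IsProper ∧
         T.dual.IsSpanTwoObservable ∧ T.dual.IsSpanTwoControllable] ∧
    (¬ T.IsLocallyIrreducible →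
      (∃ (i : ZMod n) (T' : Trellis F n),
        Trellis.IsStrictLocalReductionAt i T T' ∧
        Trellis.IsStrictLocalReductionAt i T.dual T'.dual) ∨
      (∃ (i j : ZMod n) (T' T'' : Trellis F n),
        (Trellis.IsLocalReductionAt i T T' ∧ Trellis.IsStrictLocalReductionAt j T' T'') ∧
        (Trellis.IsLocalReductionAt i T.dual T'.dual ∧
          Trellis.IsStrictLocalReductionAt j T'.dual T''.dual))) :=
  mainTheorem1_general C hC hC' T hT
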